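/- Let $n\ge 1$ and let $a_{ij}:\mathbb R^n\times\mathbb R\to\mathbb R$ ($1\le i,j\le n$) and $f:\mathbb R^n\times\mathbb R\times\mathbb R^n\to\mathbb R$ be arbitrary functions (not even assumed measurable) such that $$\sum_{i,j=1}^n a_{ij}(x,\zeta)\xi_i\xi_j>0\qquad\text{for all }x\in\mathbb R^n,\ \zeta\in\mathbb R\setminus\{0\},\ \xi\in\mathbb R^n\setminus\{0\}.$$ Let $g,h:(0,\infty)\to(0,\infty)$ and $p:\mathbb R^n\to[0,\infty)$ be locally bounded measurable functions such that $\inf_K g>0$ and $\inf_K h>0$ for every compact set $K\subset(0,\infty)$, and $$f(x,\zeta,\lambda x)\,\operatorname{sign}\zeta\ \ge\ p(x)\,g(|\zeta|)\Bigl(1+\sum_{i,j=1}^n|a_{ij}(x,\zeta)|\Bigr)$$ for all $x\in\mathbb R^n$, $\zeta\in\mathbb R\setminus\{0\}$ and $0\le\lambda\le p(x)h(|\zeta|)$. Put $q(r)=\inf_{|y|<r}p(y)$ for $r>0$ and, for $\varphi:(0,\infty)\to(0,\infty)$ and $\theta>1$, $\varphi_\theta(\zeta)=\inf_{(\zeta/\theta,\,\theta\zeta)}\varphi$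 for $\zeta>0$. Suppose that for some real number $\theta>1$ $$\int_1^\infty r\,q(r)\,dr=\infty,\qquad \int_1^\infty (g_\theta(\zeta)\,\zeta)^{-1/2}\,d\zeta<\infty,\qquad \int_1^\infty\frac{d\zeta}{h_\theta(\zeta)}<\infty.$$ Let $u:\mathbb R^n\times(0,\infty)\to\mathbb R$ be a classical solution of $$\frac{\partial u}{\partial t}-\sum_{i,j=1}^n a_{ij}(x,u)\frac{\partial^2u}{\partial x_i\partial x_j}+f(x,u,Du)\le 0\quad\text{in }\mathbb R^n\times(0,\infty),$$ where $Du$ is the gradient in $x$; that is, $u$, $Du$, the second derivatives of $u$ in $x$, and $\partial u/\partial t$ exist and are continuous in $\mathbb R^n\times(0,\infty)$, and the inequality holds at every point. Then, with $u_+=\max\{u,0\}$, $$\lim_{t\to\infty}\ \sup_{x\in K}u_+(x,t)=0\qquad\text{for every compact set }K\subset\mathbb R^n.$$ -/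

import Mathlib

open Set Filter Topology MeasureTheory

noncomputable section

/-- `q(r) = inf_{B_r} p`, where `B_r` is the open ball of radius `r` centred at the origin.
It is used for `p ≥ 0` and `r > 0`, so that the infimum is over a nonempty set bounded below. -/
def ballInf {n : ℕ} (p : EuclideanSpace ℝ (Fin n) → ℝ) (r : ℝ) : ℝ :=
  sInf (p '' Metric.ball 0 r)

/-- `φ_θ(ζ) = inf_{(ζ/θ, θζ)} φ`. It is used for `φ > 0` on `(0, ∞)`, `θ > 1` and `ζ > 0`, so that
the infimum is over a nonempty set bounded below. -/
def dilInf (θ : ℝ) (φ : ℝ → ℝ) (ζ : ℝ) : ℝ :=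
  sInf (φ '' Ioo (ζ / θ) (θ * ζ))

/-- `∂u/∂t (x, t)`. -/
def timeDeriv {n : ℕ} (u : EuclideanSpace ℝ (Fin n) → ℝ → ℝ)
    (x : EuclideanSpace ℝ (Fin n)) (t : ℝ) : ℝ :=
  deriv (fun s => u x s) t

/-- `D u (x, t)`, the gradient in the space variables. -/
def spaceGrad {n : ℕ} (u : EuclideanSpace ℝ (Fin n) → ℝ → ℝ)
    (x : EuclideanSpace ℝ (Fin n)) (t : ℝ) : EuclideanSpace ℝ (Fin n) :=
  gradient (fun y => u y t) x

/-- The second differential of `u(·, t)` at `x`, as a bilinear form. -/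
def spaceHess {n : ℕ} (u : EuclideanSpace ℝ (Fin n) → ℝ → ℝ)
    (x : EuclideanSpace ℝ (Fin n)) (t : ℝ) :
    EuclideanSpace ℝ (Fin n) →L[ℝ] EuclideanSpace ℝ (Fin n) →L[ℝ] ℝ :=
  fderiv ℝ (fderiv ℝ (fun y => u y t)) x

/-- `∂²u/∂x_i∂x_j (x, t)`. -/
def spaceDeriv₂ {n : ℕ} (u : EuclideanSpace ℝ (Fin n) → ℝ → ℝ) (i j : Fin n)
    (x : EuclideanSpace ℝ (Fin n)) (t : ℝ) : ℝ :=
  spaceHess u x t (EuclideanSpace.single i 1) (EuclideanSpace.single j 1)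

/-- `u` has two continuous derivatives in `x` and one continuous derivative in `t` on
`ℝⁿ × (0, ∞)`: the derivatives exist there, and `u`, `Du`, `D²u`, `u_t` are continuous functions
of `(x, t)`. The values of `u` for `t ≤ 0` play no role. -/
structure IsC21 {n : ℕ} (u : EuclideanSpace ℝ (Fin n) → ℝ → ℝ) : Prop where
  contDiff_space : ∀ t, 0 < t → ContDiff ℝ 2 (fun x => u x t)
  differentiableAt_time : ∀ x t, 0 < t → DifferentiableAt ℝ (fun s => u x s) t
  continuousOn :
    ContinuousOn (fun z : EuclideanSpace ℝ (Fin n) × ℝ => u z.1 z.2) (univ ×ˢ Ioi 0)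
  continuousOn_spaceGrad :
    ContinuousOn (fun z : EuclideanSpace ℝ (Fin n) × ℝ => spaceGrad u z.1 z.2) (univ ×ˢ Ioi 0)
  continuousOn_spaceHess :
    ContinuousOn (fun z : EuclideanSpace ℝ (Fin n) × ℝ => spaceHess u z.1 z.2) (univ ×ˢ Ioi 0)
  continuousOn_timeDeriv :
    ContinuousOn (fun z : EuclideanSpace ℝ (Fin n) × ℝ => timeDeriv u z.1 z.2) (univ ×ˢ Ioi 0)

/-- `u` is a classical solution of
`u_t - ∑ a_ij(x, u) u_{x_i x_j} + f(x, u, Du) ≤ 0` in `ℝⁿ × (0, ∞)`. -/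
structure IsClassicalSubsolution {n : ℕ}
    (a : Fin n → Fin n → EuclideanSpace ℝ (Fin n) → ℝ → ℝ)
    (f : EuclideanSpace ℝ (Fin n) → ℝ → EuclideanSpace ℝ (Fin n) → ℝ)
    (u : EuclideanSpace ℝ (Fin n) → ℝ → ℝ) : Prop where
  isC21 : IsC21 u
  inequality : ∀ x t, 0 < t →
    timeDeriv u x t - ∑ i, ∑ j, a i j x (u x t) * spaceDeriv₂ u i j x t
      + f x (u x t) (spaceGrad u x t) ≤ 0

/-- The hypotheses on the functions `g, h : (0, ∞) → (0, ∞)`: Lebesgue measurable, bounded on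
every compact subset of `(0, ∞)`, and bounded below there by a positive constant. A function on
`(0, ∞)` is represented by a function on `ℝ` whose values on `(-∞, 0]` play no role. -/
structure IsAdmissible (φ : ℝ → ℝ) : Prop where
  pos : ∀ ζ, 0 < ζ → 0 < φ ζ
  aemeasurable : AEMeasurable φ (volume.restrict (Ioi 0))
  bounded : ∀ K : Set ℝ, IsCompact K → K ⊆ Ioi 0 → ∃ C, ∀ ζ ∈ K, φ ζ ≤ C
  inf_pos : ∀ K : Set ℝ, IsCompact K → K ⊆ Ioi 0 → ∃ c, 0 < c ∧ ∀ ζ ∈ K, c ≤ φ ζ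

end

/-! Fix ε > 0. For a large time T, compare u with a barrier W(S), S = |x|²/2 + T - t, on the compact
cap S ≤ R, t ≤ T. The profile W equals ε for S ≤ 4^k₀, a region containing K at time T, and on S = R
it takes a value larger than u. If u stays below W in the cap, then u ≤ ε on K at time T. Nothing is
known about the size of u, so R must not depend on the height of W at R; then every T > R is
admissible.

At a first contact Du = W'(S) x, so the hypothesis on f applies with λ = W'(S). The differential
inequality is violated there as soon as W' ≤ p h(W) and W' + 2S|W''| ≤ p g(W)/2 (`not_touching`,
`lt_barrier`).

Such a W is a composition Y ∘ P of smooth staircases (`exists_profile`). Y climbs the levels ζ_j = ε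
√θ^j; the step from ζ_j to ζ_{j+1} = ζ_j + d_j has length a constant times d_j/γ_j + √(d_j/γ_j) +
d_j/η_j, with γ_j, η_j lower bounds of g, h on the step. The two convergent integrals make these
lengths summable (`summable_sqrt_levels_div`, `summable_levels_div`), so arbitrarily high levels are
reached within a fixed total length. P is a slow clock, gaining min(1, 4^k q(2^(k+2))) over [4^k,
4^(k+1)]. The divergent integral makes these gains non-summable (`not_summable_ballInf`), so P
exceeds that total length at a finite R, whatever the height. Flatness of the staircases at their
knots removes any need for continuity of g and h. -/

/-! ### Smooth staircases -/

theorem deriv_smoothTransition_eq_zero {x : ℝ} (hx : x ∉ Ioo (0 : ℝ) 1) :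
    deriv Real.smoothTransition x = 0 ∧ deriv (deriv Real.smoothTransition) x = 0 := by
  have hC : ContDiff ℝ 2 Real.smoothTransition := Real.smoothTransition.contDiff
  have c1 : Continuous (deriv Real.smoothTransition) := hC.continuous_deriv (by norm_num)
  have c2 : Continuous (deriv (deriv Real.smoothTransition)) := by
    have : ContDiff ℝ (1 + 1) Real.smoothTransition := by simpa [one_add_one_eq_two] using hC
    exact ((contDiff_succ_iff_deriv.1 this).2.2).continuous_deriv le_rfl
  -- Passing to the closure by continuity of both derivatives covers the endpoints 0 and 1.
  have key : ∀ U : Set ℝ, IsOpen U → (∃ c, ∀ y ∈ U, Real.smoothTransition y = c) →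
      x ∈ closure U →
      deriv Real.smoothTransition x = 0 ∧ deriv (deriv Real.smoothTransition) x = 0 := by
    rintro U hU ⟨c, hc⟩ hxU
    have h1 : ∀ y ∈ U, deriv Real.smoothTransition y = 0 := by
      intro y hy
      have : Real.smoothTransition =ᶠ[𝓝 y] fun _ => c :=
        eventually_of_mem (hU.mem_nhds hy) hc
      rw [this.deriv_eq]; simp
    have h2 : ∀ y ∈ U, deriv (deriv Real.smoothTransition) y = 0 := by
      intro y hy
      have : deriv Real.smoothTransition =ᶠ[𝓝 y] fun _ => 0 :=
        eventually_of_mem (hU.mem_nhds hy) h1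
      rw [this.deriv_eq]; simp
    exact ⟨closure_minimal h1 (isClosed_eq c1 continuous_const) hxU,
      closure_minimal h2 (isClosed_eq c2 continuous_const) hxU⟩
  rcases le_or_gt x 0 with h | h
  · refine key (Iio 0) isOpen_Iio ⟨0, fun y hy => ?_⟩ (by rw [closure_Iio]; exact h)
    exact Real.smoothTransition.zero_of_nonpos (le_of_lt hy)
  · have h1 : 1 ≤ x := by
      by_contra h1
      exact hx ⟨h, not_le.1 h1⟩
    refine key (Ioi 1) isOpen_Ioi ⟨1, fun y hy => ?_⟩ (by rw [closure_Ioi]; exact h1)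
    exact Real.smoothTransition.one_of_one_le (le_of_lt hy)

theorem exists_bound_deriv_smoothTransition :
    ∃ C : ℝ, 1 ≤ C ∧ ∀ x, deriv Real.smoothTransition x ≤ C ∧
      |deriv (deriv Real.smoothTransition) x| ≤ C := by
  have hC : ContDiff ℝ 2 Real.smoothTransition := Real.smoothTransition.contDiff
  have c1 : Continuous (deriv Real.smoothTransition) := hC.continuous_deriv (by norm_num)
  have c2 : Continuous (deriv (deriv Real.smoothTransition)) := by
    have : ContDiff ℝ (1 + 1) Real.smoothTransition := by simpa [one_add_one_eq_two] using hC
    exact ((contDiff_succ_iff_deriv.1 this).2.2).continuous_deriv le_rfl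
  obtain ⟨A, hA⟩ := (isCompact_Icc (a := (0 : ℝ)) (b := 1)).exists_bound_of_continuousOn
    c1.continuousOn
  obtain ⟨B, hB⟩ := (isCompact_Icc (a := (0 : ℝ)) (b := 1)).exists_bound_of_continuousOn
    c2.continuousOn
  refine ⟨max 1 (max A B), le_max_left _ _, fun x => ?_⟩
  by_cases hx : x ∈ Ioo (0 : ℝ) 1
  · have hx' := Ioo_subset_Icc_self hx
    exact ⟨(le_abs_self _).trans ((hA x hx').trans (by simp)), (hB x hx').trans (by simp)⟩
  · obtain ⟨h1, h2⟩ := deriv_smoothTransition_eq_zero hx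
    rw [h1, h2]
    simp

/-- The smooth staircase through the points `(s j, v j)`, `j ≤ N`. -/
noncomputable def stair (s v : ℕ → ℝ) (N : ℕ) (x : ℝ) : ℝ :=
  v 0 + ∑ j ∈ Finset.range N,
    (v (j + 1) - v j) * Real.smoothTransition ((x - s j) / (s (j + 1) - s j))

theorem contDiff_stair (s v : ℕ → ℝ) (N : ℕ) : ContDiff ℝ 2 (stair s v N) := by
  unfold stair
  refine contDiff_const.add (ContDiff.sum fun j _ => contDiff_const.mul ?_)
  exact Real.smoothTransition.contDiff.comp ((contDiff_id.sub contDiff_const).div_const _)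

theorem deriv_stair (s v : ℕ → ℝ) (N : ℕ) : deriv (stair s v N) = fun x =>
    ∑ j ∈ Finset.range N, (v (j + 1) - v j) / (s (j + 1) - s j) *
      deriv Real.smoothTransition ((x - s j) / (s (j + 1) - s j)) := by
  have hC : ContDiff ℝ 2 Real.smoothTransition := Real.smoothTransition.contDiff
  funext x
  refine HasDerivAt.deriv ?_
  refine HasDerivAt.const_add _ (HasDerivAt.fun_sum fun j _ => ?_)
  have h1 : HasDerivAt (fun x => (x - s j) / (s (j + 1) - s j)) (1 / (s (j + 1) - s j)) x :=
    ((hasDerivAt_id x).sub_const _).div_const _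
  have h2 := ((hC.differentiable (by norm_num)).differentiableAt.hasDerivAt
    (x := (x - s j) / (s (j + 1) - s j))).comp x h1
  exact (h2.const_mul (v (j + 1) - v j)).congr_deriv (by ring)

theorem deriv_deriv_stair (s v : ℕ → ℝ) (N : ℕ) : deriv (deriv (stair s v N)) = fun x =>
    ∑ j ∈ Finset.range N, (v (j + 1) - v j) / (s (j + 1) - s j) ^ 2 *
      deriv (deriv Real.smoothTransition) ((x - s j) / (s (j + 1) - s j)) := by
  have hC : ContDiff ℝ (1 + 1) Real.smoothTransition := Real.smoothTransition.contDiff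
  have hC1 := (contDiff_succ_iff_deriv.1 hC).2.2
  rw [deriv_stair]
  funext x
  refine HasDerivAt.deriv ?_
  refine HasDerivAt.fun_sum fun j _ => ?_
  have h1 : HasDerivAt (fun x => (x - s j) / (s (j + 1) - s j)) (1 / (s (j + 1) - s j)) x :=
    ((hasDerivAt_id x).sub_const _).div_const _
  have h2 := ((hC1.differentiable (by norm_num)).differentiableAt.hasDerivAt
    (x := (x - s j) / (s (j + 1) - s j))).comp x h1
  refine (h2.const_mul ((v (j + 1) - v j) / (s (j + 1) - s j))).congr_deriv ?_
  rw [sq, ← div_div]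
  ring

theorem deriv_stair_nonneg {s v : ℕ → ℝ} (hs : StrictMono s) (hv : Monotone v) (N : ℕ) (x : ℝ) :
    0 ≤ deriv (stair s v N) x := by
  rw [deriv_stair]
  refine Finset.sum_nonneg fun j _ => mul_nonneg (div_nonneg ?_ ?_) ?_
  · exact sub_nonneg.2 (hv j.le_succ)
  · exact sub_nonneg.2 (hs j.lt_succ_self).le
  · exact Real.smoothTransition.monotone.deriv_nonneg

theorem stair_of_le {s v : ℕ → ℝ} (hs : StrictMono s) (N : ℕ) {x : ℝ} (hx : x ≤ s 0) :
    stair s v N x = v 0 := by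
  unfold stair
  rw [Finset.sum_eq_zero, add_zero]
  intro j _
  rw [Real.smoothTransition.zero_of_nonpos, mul_zero]
  exact div_nonpos_of_nonpos_of_nonneg (by linarith [hs.monotone (Nat.zero_le j)])
    (by linarith [hs j.lt_succ_self])

theorem le_stair {s v : ℕ → ℝ} (hv : Monotone v) (N : ℕ) (x : ℝ) : v 0 ≤ stair s v N x := by
  unfold stair
  have : 0 ≤ ∑ j ∈ Finset.range N,
      (v (j + 1) - v j) * Real.smoothTransition ((x - s j) / (s (j + 1) - s j)) :=
    Finset.sum_nonneg fun j _ => mul_nonneg (sub_nonneg.2 (hv j.le_succ))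
      (Real.smoothTransition.nonneg _)
  linarith

theorem stair_of_ge {s v : ℕ → ℝ} (hs : StrictMono s) (N : ℕ) {x : ℝ} (hx : s N ≤ x) :
    stair s v N x = v N := by
  unfold stair
  rw [Finset.sum_congr rfl (g := fun j => v (j + 1) - v j), Finset.sum_range_sub]
  · ring
  intro j hj
  rw [Real.smoothTransition.one_of_one_le, mul_one]
  rw [one_le_div (by linarith [hs j.lt_succ_self])]
  linarith [hs.monotone (Finset.mem_range.1 hj)]

theorem div_notMem_Ioo_of_notMem {s : ℕ → ℝ} (hs : StrictMono s) {j : ℕ} {x : ℝ}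
    (hx : x ∉ Ioo (s j) (s (j + 1))) : (x - s j) / (s (j + 1) - s j) ∉ Ioo (0 : ℝ) 1 := by
  have h0 : 0 < s (j + 1) - s j := sub_pos.2 (hs j.lt_succ_self)
  rintro ⟨h1, h2⟩
  rw [div_lt_one h0] at h2
  have h3 := (div_pos_iff_of_pos_right h0).1 h1
  exact hx ⟨by linarith, by linarith⟩

/-- Off the open steps, the staircase is flat to second order; on a step, its values lie between
the values at the ends and its derivatives are bounded by the difference quotients. -/
theorem stair_local {s v : ℕ → ℝ} (hs : StrictMono s) (hv : Monotone v) (N : ℕ) {C : ℝ}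
    (hC : ∀ x, deriv Real.smoothTransition x ≤ C ∧
      |deriv (deriv Real.smoothTransition) x| ≤ C) (x : ℝ) :
    (deriv (stair s v N) x = 0 ∧ deriv (deriv (stair s v N)) x = 0) ∨
    ∃ j < N, x ∈ Ioo (s j) (s (j + 1)) ∧ stair s v N x ∈ Icc (v j) (v (j + 1)) ∧
      deriv (stair s v N) x ≤ C * ((v (j + 1) - v j) / (s (j + 1) - s j)) ∧
      |deriv (deriv (stair s v N)) x| ≤ C * ((v (j + 1) - v j) / (s (j + 1) - s j) ^ 2) := by
  by_cases hx : ∃ j < N, x ∈ Ioo (s j) (s (j + 1))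
  · right
    obtain ⟨j, hj, hxj⟩ := hx
    have hd : 0 < s (j + 1) - s j := sub_pos.2 (hs j.lt_succ_self)
    have hdv : 0 ≤ v (j + 1) - v j := sub_nonneg.2 (hv j.le_succ)
    have hoff : ∀ i ∈ Finset.range N, i ≠ j →
        (x - s i) / (s (i + 1) - s i) ∉ Ioo (0 : ℝ) 1 := by
      intro i _ hij
      refine div_notMem_Ioo_of_notMem hs fun hxi => hij ?_
      have h1 : i < j + 1 := hs.lt_iff_lt.1 (hxi.1.trans hxj.2)
      have h2 : j < i + 1 := hs.lt_iff_lt.1 (hxj.1.trans hxi.2)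
      omega
    refine ⟨j, hj, hxj, ?_, ?_, ?_⟩
    · have e : stair s v N x = v j +
          (v (j + 1) - v j) * Real.smoothTransition ((x - s j) / (s (j + 1) - s j)) := by
        unfold stair
        -- Steps before j are complete and telescope to `v j`; steps after j have not begun.
        obtain ⟨m, rfl⟩ : ∃ m, N = j + 1 + m := ⟨N - (j + 1), by omega⟩
        rw [Finset.sum_range_add, Finset.sum_range_succ, Finset.sum_congr rfl
          (g := fun i => v (i + 1) - v i), Finset.sum_range_sub, Finset.sum_eq_zero
          (s := Finset.range m)]
        · ring
        · intro i _
          rw [Real.smoothTransition.zero_of_nonpos, mul_zero]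
          refine div_nonpos_of_nonpos_of_nonneg ?_ ?_
          · linarith [hxj.2, hs.monotone (show j + 1 ≤ j + 1 + i by omega)]
          · linarith [hs (j + 1 + i).lt_succ_self]
        · intro i hi
          rw [Real.smoothTransition.one_of_one_le, mul_one]
          rw [one_le_div (by linarith [hs i.lt_succ_self])]
          linarith [hxj.1, hs.monotone (Finset.mem_range.1 hi)]
      rw [e]
      have h0 := Real.smoothTransition.nonneg ((x - s j) / (s (j + 1) - s j))
      have h1 := Real.smoothTransition.le_one ((x - s j) / (s (j + 1) - s j))
      constructor <;> nlinarith
    · rw [deriv_stair]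
      simp only
      rw [Finset.sum_eq_single_of_mem j (Finset.mem_range.2 hj), mul_comm C]
      · exact mul_le_mul_of_nonneg_left (hC _).1 (div_nonneg hdv hd.le)
      · intro i hi hij
        rw [(deriv_smoothTransition_eq_zero (hoff i hi hij)).1, mul_zero]
    · rw [deriv_deriv_stair]
      simp only
      rw [Finset.sum_eq_single_of_mem j (Finset.mem_range.2 hj), mul_comm C, abs_mul,
        abs_of_nonneg (by positivity)]
      · exact mul_le_mul_of_nonneg_left (hC _).2 (by positivity)
      · intro i hi hij
        rw [(deriv_smoothTransition_eq_zero (hoff i hi hij)).2, mul_zero]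
  · left
    push Not at hx
    rw [deriv_deriv_stair, deriv_stair]
    constructor
    · refine Finset.sum_eq_zero fun i hi => ?_
      rw [(deriv_smoothTransition_eq_zero
        (div_notMem_Ioo_of_notMem hs (hx i (Finset.mem_range.1 hi)))).1, mul_zero]
    · refine Finset.sum_eq_zero fun i hi => ?_
      rw [(deriv_smoothTransition_eq_zero
        (div_notMem_Ioo_of_notMem hs (hx i (Finset.mem_range.1 hi)))).2, mul_zero]

/-! ### The barrier profile -/

theorem deriv_deriv_comp {Y P : ℝ → ℝ} (hY : ContDiff ℝ 2 Y) (hP : ContDiff ℝ 2 P) (S : ℝ) :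
    deriv (Y ∘ P) S = deriv Y (P S) * deriv P S ∧
    deriv (deriv (Y ∘ P)) S =
      deriv (deriv Y) (P S) * deriv P S ^ 2 + deriv Y (P S) * deriv (deriv P) S := by
  have hY1 : ContDiff ℝ (1 + 1) Y := by simpa [one_add_one_eq_two] using hY
  have hP1 : ContDiff ℝ (1 + 1) P := by simpa [one_add_one_eq_two] using hP
  have hY2 := (contDiff_succ_iff_deriv.1 hY1).2.2.differentiable (by norm_num)
  have hP2 := (contDiff_succ_iff_deriv.1 hP1).2.2.differentiable (by norm_num)
  have dY := hY.differentiable (by norm_num)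
  have dP := hP.differentiable (by norm_num)
  have h1 : deriv (Y ∘ P) = fun S => deriv Y (P S) * deriv P S := by
    funext S
    exact ((dY (P S)).hasDerivAt.comp S (dP S).hasDerivAt).deriv
  refine ⟨congrFun h1 S, ?_⟩
  rw [h1]
  have h2 := ((hY2 (P S)).hasDerivAt.comp S (dP S).hasDerivAt).mul (hP2 S).hasDerivAt
  refine HasDerivAt.deriv (h2.congr_deriv ?_)
  simp only [Function.comp_apply]
  ring

/-- Estimates for the clock on a step [a, 4a], of length 3a, with gain μ. The cap μ ≤ 1 gives the
bound on S P'; the bound μ ≤ aQ gives the other two. -/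
theorem time_change_bounds {C a μ Q S P1 P2 : ℝ} (hC : 0 < C) (ha : 0 < a)
    (hSa : S ≤ 4 * a) (hP : 0 ≤ P1) (hμ0 : 0 ≤ μ) (hμ1 : μ ≤ 1) (hμQ : μ ≤ a * Q)
    (h1 : P1 ≤ C * (μ / (3 * a))) (h2 : |P2| ≤ C * (μ / (3 * a) ^ 2)) :
    P1 ≤ C * Q ∧ S * P1 ≤ 2 * C ∧ S * |P2| ≤ C * Q := by
  have hQ : 0 ≤ Q := nonneg_of_mul_nonneg_right (hμ0.trans hμQ) ha
  refine ⟨?_, ?_, ?_⟩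
  · refine h1.trans (mul_le_mul_of_nonneg_left ?_ hC.le)
    rw [div_le_iff₀ (by positivity)]
    nlinarith
  · have : P1 * (3 * a) ≤ C * 1 := by
      rw [← mul_div_assoc, le_div_iff₀ (by positivity)] at h1
      exact h1.trans (mul_le_mul_of_nonneg_left hμ1 hC.le)
    have : S * P1 ≤ 4 * a * P1 := by gcongr
    linarith
  · have h3 : μ / (3 * a) ^ 2 * (9 * a) ≤ Q := by
      rw [div_mul_eq_mul_div, div_le_iff₀ (by positivity)]
      nlinarith
    have h4 : |P2| * (9 * a) ≤ C * Q := by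
      calc |P2| * (9 * a) ≤ C * (μ / (3 * a) ^ 2) * (9 * a) := by gcongr
        _ = C * (μ / (3 * a) ^ 2 * (9 * a)) := by ring
        _ ≤ C * Q := by gcongr
    have h5 : S * |P2| ≤ 4 * a * |P2| := by gcongr
    have h6 : 0 ≤ a * |P2| := by positivity
    linarith

/-- Each term of Δ pays for one bound: d/γ and d/η control the slope d/Δ, and √(d/γ) controls the
second derivative, of size d/Δ². -/
theorem level_bounds {C d γ η Δ Y1 Y2 : ℝ} (hC : 1 ≤ C) (hd : 0 < d) (hγ : 0 < γ) (hη : 0 < η)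
    (hΔ : Δ = 100 * C ^ 3 * (d / γ + √(d / γ) + d / η))
    (h1 : Y1 ≤ C * (d / Δ)) (h2 : |Y2| ≤ C * (d / Δ ^ 2)) :
    100 * C ^ 2 * Y1 ≤ γ ∧ 100 * C ^ 2 * Y1 ≤ η ∧ 100 * C ^ 2 * |Y2| ≤ γ := by
  have hC0 : 0 < C := by linarith
  set A : ℝ := 100 * C ^ 3 with hA
  have hA1 : 1 ≤ A := by
    have := one_le_pow₀ hC (n := 3)
    linarith
  have hA0 : 0 < A := by linarith
  have hdγ := div_pos hd hγ
  have hdη := div_pos hd hη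
  have hΔpos : 0 < Δ := by rw [hΔ]; positivity
  have hs := Real.sqrt_nonneg (d / γ)
  have hΔ1 : A * (d / γ) ≤ Δ := by
    rw [hΔ]; gcongr; linarith
  have hΔ3 : A * (d / η) ≤ Δ := by
    rw [hΔ]; gcongr; linarith
  have hΔ2 : A * (d / γ) ≤ Δ ^ 2 := by
    have h3 : A * √(d / γ) ≤ Δ := by
      rw [hΔ]; gcongr; linarith
    calc A * (d / γ) ≤ A ^ 2 * (d / γ) := by gcongr; nlinarith
      _ = (A * √(d / γ)) ^ 2 := by rw [mul_pow A _ 2, Real.sq_sqrt hdγ.le]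
      _ ≤ Δ ^ 2 := by gcongr
  have key : ∀ {b D Z : ℝ}, 0 < b → 0 < D → A * (d / b) ≤ D → Z ≤ C * (d / D) →
      100 * C ^ 2 * Z ≤ b := by
    intro b D Z hb hD h3 h4
    refine le_of_mul_le_mul_left ?_ hC0
    calc C * (100 * C ^ 2 * Z) = A * Z := by rw [hA]; ring
      _ ≤ A * (C * (d / D)) := by gcongr
      _ = C * (A * d / D) := by ring
      _ ≤ C * b := by
        gcongr
        rw [div_le_iff₀ hD]
        rw [← mul_div_assoc, div_le_iff₀ hb] at h3
        linarith
  exact ⟨key hγ hΔpos hΔ1 h1, key hη hΔpos hΔ3 h1, key hγ (by positivity) hΔ2 h2⟩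

/-- By the chain rule the left side of the second bound is at most 3CQ Y' + 4C²Q|Y''|; the factor
100 leaves ample room below QG/2. -/
theorem composition_bounds {C Q S P1 P2 Y1 Y2 G H : ℝ} (hC : 1 ≤ C) (hQ : 0 ≤ Q) (hS : 0 < S)
    (hP : 0 ≤ P1) (hY : 0 ≤ Y1) (b1 : P1 ≤ C * Q) (b2 : S * P1 ≤ 2 * C) (b3 : S * |P2| ≤ C * Q)
    (t1 : 100 * C ^ 2 * Y1 ≤ G) (t2 : 100 * C ^ 2 * Y1 ≤ H) (t3 : 100 * C ^ 2 * |Y2| ≤ G) :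
    Y1 * P1 ≤ Q * H ∧ Y1 * P1 + 2 * S * |Y2 * P1 ^ 2 + Y1 * P2| ≤ Q * G / 2 := by
  have hC0 : 0 < C := by linarith
  have hCC : C * Y1 ≤ C ^ 2 * Y1 := by
    gcongr
    nlinarith
  have hCY : 0 ≤ C * Y1 := by positivity
  have u1 : 100 * (C * Y1) ≤ G := by linarith
  have u2 : C * Y1 ≤ H := by linarith
  constructor
  · calc Y1 * P1 ≤ Y1 * (C * Q) := by gcongr
      _ = Q * (C * Y1) := by ring
      _ ≤ Q * H := by gcongr
  · have h2 : |Y2 * P1 ^ 2 + Y1 * P2| ≤ |Y2| * P1 ^ 2 + Y1 * |P2| := by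
      refine (abs_add_le _ _).trans_eq ?_
      rw [abs_mul, abs_mul, abs_of_nonneg hY, abs_of_nonneg (sq_nonneg P1)]
    have h3 : S * |Y2 * P1 ^ 2 + Y1 * P2| ≤ (S * P1) * P1 * |Y2| + Y1 * (S * |P2|) := by
      calc _ ≤ S * (|Y2| * P1 ^ 2 + Y1 * |P2|) := by gcongr
        _ = _ := by ring
    have h4 : (S * P1) * P1 * |Y2| ≤ 2 * C * (C * Q) * |Y2| := by gcongr
    have h5 : Y1 * (S * |P2|) ≤ Y1 * (C * Q) := by gcongr
    have h6 : Y1 * P1 ≤ Y1 * (C * Q) := by gcongr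
    have h7 : Q * (100 * (C * Y1)) ≤ Q * G := by gcongr
    have h8 : Q * (100 * C ^ 2 * |Y2|) ≤ Q * G := by gcongr
    have h9 : 0 ≤ Q * (C * Y1) := by positivity
    have h10 : 0 ≤ Q * (C ^ 2 * |Y2|) := by positivity
    linarith

/-- The profile of the barrier, as a function of `S = |x|² / 2 + T - t`. -/
theorem exists_profile {g h : ℝ → ℝ} {q ζ γ η : ℕ → ℝ} (hq : ∀ k, 0 ≤ q k)
    (hqsum : ¬ Summable fun k => min 1 (4 ^ k * q k)) (hζ : StrictMono ζ)
    (hγ : ∀ j, 0 < γ j) (hη : ∀ j, 0 < η j)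
    (hlevel : ∀ j, ∀ z ∈ Icc (ζ j) (ζ (j + 1)), γ j ≤ g z ∧ η j ≤ h z)
    (hsγ : Summable fun j => √((ζ (j + 1) - ζ j) / γ j))
    (hsη : Summable fun j => (ζ (j + 1) - ζ j) / η j) (k₀ : ℕ) :
    ∃ R : ℝ, 4 ^ k₀ ≤ R ∧ ∀ N, ∃ W : ℝ → ℝ, ContDiff ℝ 2 W ∧ (∀ S ≤ 4 ^ k₀, W S = ζ 0) ∧
      (∀ S, R ≤ S → W S = ζ N) ∧ (∀ S, ζ 0 ≤ W S) ∧ (∀ S, 0 ≤ deriv W S) ∧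
      ∀ S, (deriv W S = 0 ∧ deriv (deriv W) S = 0) ∨
        ∃ k, 0 < S ∧ S ≤ 4 ^ (k + 1) ∧ deriv W S ≤ q k * h (W S) ∧
          deriv W S + 2 * S * |deriv (deriv W) S| ≤ q k * g (W S) / 2 := by
  obtain ⟨C, hC1, hC⟩ := exists_bound_deriv_smoothTransition
  have hC0 : 0 < C := by linarith
  set d : ℕ → ℝ := fun j => ζ (j + 1) - ζ j with hd
  have hdpos : ∀ j, 0 < d j := fun j => sub_pos.2 (hζ j.lt_succ_self)
  set A : ℝ := 100 * C ^ 3 with hA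
  have hApos : 0 < A := by positivity
  set Δ : ℕ → ℝ := fun j => A * (d j / γ j + √(d j / γ j) + d j / η j) with hΔ
  have hΔpos : ∀ j, 0 < Δ j := fun j => by
    have := div_pos (hdpos j) (hγ j)
    have := div_pos (hdpos j) (hη j)
    positivity
  -- Eventually √(d/γ) < 1, and then d/γ ≤ √(d/γ).
  have hsq : Summable fun j => d j / γ j := by
    have h1 : ∀ᶠ j in atTop, √(d j / γ j) < 1 :=
      hsγ.tendsto_atTop_zero.eventually (gt_mem_nhds one_pos)
    refine Summable.of_norm_bounded_eventually_nat hsγ ?_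
    filter_upwards [h1] with j hj
    have hp := div_pos (hdpos j) (hγ j)
    rw [Real.norm_of_nonneg hp.le]
    nlinarith [Real.sq_sqrt hp.le, Real.sqrt_nonneg (d j / γ j)]
  have hΔsum : Summable Δ := ((hsq.add hsγ).add hsη).mul_left A
  set s : ℕ → ℝ := fun j => ∑ i ∈ Finset.range j, Δ i with hs
  have hsmono : StrictMono s := strictMono_nat_of_lt_succ fun j => by
    simp only [hs, Finset.sum_range_succ]
    linarith [hΔpos j]
  have hsd : ∀ j, s (j + 1) - s j = Δ j := fun j => by
    simp [hs, Finset.sum_range_succ]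
  -- The shift by k₀ keeps the clock at 0 until S = 4^k₀.
  set μ : ℕ → ℝ := fun k => min 1 (4 ^ (k + k₀) * q (k + k₀)) with hμ
  have hμ0 : ∀ k, 0 ≤ μ k := fun k => le_min zero_le_one (mul_nonneg (by positivity) (hq _))
  have hμsum : ¬ Summable μ := fun H =>
    hqsum ((summable_nat_add_iff (f := fun k => min 1 (4 ^ k * q k)) k₀).1 H)
  have hμtop := (not_summable_iff_tendsto_nat_atTop_of_nonneg hμ0).1 hμsum
  -- The clock passes the total length of all steps of Y. Since n is chosen before N, the radius R
  -- serves every N.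
  obtain ⟨n, hn⟩ := (hμtop.eventually (eventually_ge_atTop (∑' j, Δ j))).exists
  set w : ℕ → ℝ := fun k => ∑ i ∈ Finset.range k, μ i with hw
  have hwmono : Monotone w := monotone_nat_of_le_succ fun k => by
    simp only [hw, Finset.sum_range_succ]
    linarith [hμ0 k]
  have hwd : ∀ k, w (k + 1) - w k = μ k := fun k => by
    simp [hw, Finset.sum_range_succ]
  set r : ℕ → ℝ := fun k => 4 ^ (k + k₀) with hr
  have hrmono : StrictMono r := fun i j hij => by
    simp only [hr]
    exact pow_lt_pow_right₀ (by norm_num) (by omega)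
  have hrd : ∀ k, r (k + 1) - r k = 3 * 4 ^ (k + k₀) := fun k => by
    simp only [hr]; ring
  set P := stair r w n with hP
  have hw0 : w 0 = 0 := by simp [hw]
  have hs0 : s 0 = 0 := by simp [hs]
  refine ⟨r n, by simp only [hr]; exact pow_le_pow_right₀ (by norm_num) (by omega), fun N => ?_⟩
  set Y := stair s ζ N with hY
  have cP : ContDiff ℝ 2 P := contDiff_stair r w n
  have cY : ContDiff ℝ 2 Y := contDiff_stair s ζ N
  have hYn := fun x => deriv_stair_nonneg hsmono hζ.monotone N x
  have hPn := fun x => deriv_stair_nonneg hrmono hwmono n x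
  refine ⟨Y ∘ P, cY.comp cP, fun S hS => ?_, fun S hS => ?_,
    fun S => le_stair hζ.monotone N _, fun S => ?_, fun S => ?_⟩
  · have h1 : P S = 0 := by
      rw [hP, stair_of_le hrmono n (by simpa [hr] using hS), hw0]
    rw [Function.comp_apply, h1, hY, stair_of_le hsmono N hs0.ge]
  · have h1 : P S = w n := by rw [hP, stair_of_ge hrmono n hS]
    rw [Function.comp_apply, h1, hY, stair_of_ge hsmono N]
    exact (hΔsum.sum_le_tsum _ fun i _ => (hΔpos i).le).trans hn
  · rw [(deriv_deriv_comp cY cP S).1]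
    exact mul_nonneg (hYn _) (hPn _)
  · obtain ⟨e1, e2⟩ := deriv_deriv_comp cY cP S
    rcases stair_local hrmono hwmono n hC S with ⟨p1, p2⟩ | ⟨k, -, hkS, -, p1, p2⟩
    · left
      rw [e1, e2, p1, p2]
      simp
    rcases stair_local hsmono hζ.monotone N hC (P S) with ⟨y1, y2⟩ | ⟨j, -, -, hjY, y1, y2⟩
    · left
      rw [e1, e2, y1, y2]
      simp
    right
    have hS0 : 0 < S := lt_trans (by simp only [hr]; positivity) hkS.1
    obtain ⟨hg, hh⟩ := hlevel j _ hjY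
    rw [hwd, hrd] at p1 p2
    rw [hsd] at y1 y2
    change deriv P S ≤ _ at p1
    change |deriv (deriv P) S| ≤ _ at p2
    change deriv Y (P S) ≤ _ at y1
    change |deriv (deriv Y) (P S)| ≤ _ at y2
    change γ j ≤ g (Y (P S)) at hg
    change η j ≤ h (Y (P S)) at hh
    have hY0 : 0 ≤ deriv Y (P S) := hYn _
    have hP0 : 0 ≤ deriv P S := hPn _
    rw [e1, e2]
    simp only [Function.comp_apply]
    generalize deriv (deriv Y) (P S) = Y2 at *
    generalize deriv (deriv P) S = P2 at *
    generalize deriv Y (P S) = Y1 at *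
    generalize deriv P S = P1 at *
    generalize g (Y (P S)) = G at *
    generalize h (Y (P S)) = H at *
    set a : ℝ := 4 ^ (k + k₀) with ha
    have ha0 : 0 < a := by positivity
    have hSa : S ≤ 4 * a := by
      have := hkS.2.le
      simp only [hr] at this
      rw [ha]
      calc S ≤ _ := this
        _ = _ := by ring
    set Q := q (k + k₀) with hQ
    have hQ0 : 0 ≤ Q := hq _
    have hμ1 : μ k ≤ 1 := min_le_left _ _
    have hμQ : μ k ≤ a * Q := min_le_right _ _
    have hμk := hμ0 k
    obtain ⟨b1, b2, b3⟩ := time_change_bounds hC0 ha0 hSa hP0 hμk hμ1 hμQ p1 p2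
    obtain ⟨t1, t2, t3⟩ := level_bounds hC1 (hdpos j) (hγ j) (hη j) rfl y1 y2
    exact ⟨k + k₀, hS0, hkS.2.le.trans_eq (by simp only [hr]; congr 1; omega),
      composition_bounds hC1 hQ0 hS0 hP0 hY0 b1 b2 b3 (t1.trans hg) (t2.trans hh) (t3.trans hg)⟩

/-! ### The divergent integral of r q(r) -/

theorem ballInf_le {n : ℕ} {p : EuclideanSpace ℝ (Fin n) → ℝ} (hp : ∀ x, 0 ≤ p x) {r : ℝ}
    {x : EuclideanSpace ℝ (Fin n)} (hx : ‖x‖ < r) : ballInf p r ≤ p x :=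
  csInf_le ⟨0, by rintro _ ⟨y, -, rfl⟩; exact hp y⟩ ⟨x, by simpa using hx, rfl⟩

theorem ballInf_nonneg {n : ℕ} {p : EuclideanSpace ℝ (Fin n) → ℝ} (hp : ∀ x, 0 ≤ p x) (r : ℝ) :
    0 ≤ ballInf p r :=
  Real.sInf_nonneg (by rintro _ ⟨y, -, rfl⟩; exact hp y)

theorem ballInf_anti {n : ℕ} {p : EuclideanSpace ℝ (Fin n) → ℝ} (hp : ∀ x, 0 ≤ p x) {r r' : ℝ}
    (hr : 0 < r) (hrr' : r ≤ r') : ballInf p r' ≤ ballInf p r :=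
  csInf_le_csInf ⟨0, by rintro _ ⟨y, -, rfl⟩; exact hp y⟩
    ((Metric.nonempty_ball.2 hr).image p) (image_mono (Metric.ball_subset_ball hrr'))

/-- As q is nonincreasing, a zero at r would persist beyond r and leave a bounded integrand on (1,
r]. Hence p is positive everywhere. -/
theorem ballInf_pos {n : ℕ} {p : EuclideanSpace ℝ (Fin n) → ℝ} (hp : ∀ x, 0 ≤ p x)
    (hq : ∫⁻ r in Ioi (1 : ℝ), ENNReal.ofReal (r * ballInf p r) = ⊤) (r : ℝ) (hr : 0 < r) :
    0 < ballInf p r := by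
  refine (ballInf_nonneg hp r).lt_of_ne' fun h0 => ?_
  have hle : ∀ x ∈ Ioi (1 : ℝ), ENNReal.ofReal (x * ballInf p x) ≤
      (Ioc 1 r).indicator (fun _ => ENNReal.ofReal (r * ballInf p 1)) x := by
    intro x hx
    by_cases hxr : x ≤ r
    · rw [indicator_of_mem (show x ∈ Ioc 1 r from ⟨hx, hxr⟩)]
      refine ENNReal.ofReal_le_ofReal (mul_le_mul hxr (ballInf_anti hp one_pos (le_of_lt hx))
        (ballInf_nonneg hp _) hr.le)
    · have : ballInf p x = 0 := le_antisymm
        (h0 ▸ ballInf_anti hp hr (not_le.1 hxr).le) (ballInf_nonneg hp _)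
      simp [this]
  have h2 := setLIntegral_mono' (μ := volume) measurableSet_Ioi hle
  rw [hq, top_le_iff] at h2
  refine (lt_top_iff_ne_top.1 ?_) h2
  refine (setLIntegral_le_lintegral _ _).trans_lt ?_
  rw [lintegral_indicator measurableSet_Ioc, setLIntegral_const, Real.volume_Ioc]
  exact ENNReal.mul_lt_top ENNReal.ofReal_lt_top ENNReal.ofReal_lt_top

/-- If the truncated series converged, its terms would eventually be below 1, so the truncation
would be inactive; monotonicity of q on dyadic shells would then bound the integral. -/
theorem not_summable_ballInf {n : ℕ} {p : EuclideanSpace ℝ (Fin n) → ℝ} (hp : ∀ x, 0 ≤ p x)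
    (hq : ∫⁻ r in Ioi (1 : ℝ), ENNReal.ofReal (r * ballInf p r) = ⊤) :
    ¬ Summable fun k : ℕ => min 1 (4 ^ k * ballInf p (2 ^ (k + 2))) := by
  intro H
  have h1 : ∀ᶠ k : ℕ in atTop, min 1 ((4 : ℝ) ^ k * ballInf p (2 ^ (k + 2))) < 1 :=
    H.tendsto_atTop_zero.eventually (gt_mem_nhds one_pos)
  have H2 : Summable fun k : ℕ => (4 : ℝ) ^ k * ballInf p (2 ^ (k + 2)) := by
    refine Summable.of_norm_bounded_eventually_nat H ?_
    filter_upwards [h1] with k hk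
    rw [Real.norm_of_nonneg (mul_nonneg (by positivity) (ballInf_nonneg hp _))]
    rw [min_lt_iff] at hk
    rw [min_eq_right]
    exact (hk.resolve_left (lt_irrefl _)).le
  have H3 : Summable fun k : ℕ => (4 : ℝ) ^ (k + 1) * ballInf p (2 ^ k) := by
    refine (summable_nat_add_iff (f := fun k : ℕ => (4 : ℝ) ^ (k + 1) * ballInf p (2 ^ k)) 2).1 ?_
    refine (H2.mul_left 64).congr fun k => ?_
    ring
  have hcover : Ioi (1 : ℝ) ⊆ ⋃ k : ℕ, Ico ((2 : ℝ) ^ k) (2 ^ (k + 1)) := by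
    intro x hx
    obtain ⟨k, hk⟩ := exists_nat_pow_near (le_of_lt hx) (one_lt_two (α := ℝ))
    exact mem_iUnion.2 ⟨k, hk⟩
  have hpiece : ∀ k : ℕ, ∫⁻ r in Ico ((2 : ℝ) ^ k) (2 ^ (k + 1)),
      ENNReal.ofReal (r * ballInf p r) ≤ ENNReal.ofReal (4 ^ (k + 1) * ballInf p (2 ^ k)) := by
    intro k
    have hk0 : (0 : ℝ) < 2 ^ k := by positivity
    have : ∀ r ∈ Ico ((2 : ℝ) ^ k) (2 ^ (k + 1)), ENNReal.ofReal (r * ballInf p r) ≤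
        ENNReal.ofReal (2 ^ (k + 1) * ballInf p (2 ^ k)) := fun r hr =>
      ENNReal.ofReal_le_ofReal (mul_le_mul hr.2.le (ballInf_anti hp hk0 hr.1)
        (ballInf_nonneg hp _) (by positivity))
    refine (setLIntegral_mono' measurableSet_Ico this).trans ?_
    rw [setLIntegral_const, Real.volume_Ico, ← ENNReal.ofReal_mul (mul_nonneg (by positivity)
      (ballInf_nonneg hp _))]
    refine ENNReal.ofReal_le_ofReal ?_
    have e : (4 : ℝ) ^ (k + 1) = 2 ^ (k + 1) * 2 ^ (k + 1) := by
      rw [← mul_pow]; norm_num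
    have : (2 : ℝ) ^ (k + 1) - 2 ^ k ≤ 2 ^ (k + 1) := by linarith
    rw [e]
    nlinarith [mul_nonneg (show (0 : ℝ) ≤ 2 ^ (k + 1) by positivity)
      (ballInf_nonneg hp ((2 : ℝ) ^ k))]
  have : ∫⁻ r in Ioi (1 : ℝ), ENNReal.ofReal (r * ballInf p r) < ⊤ := by
    calc _ ≤ ∫⁻ r in ⋃ k : ℕ, Ico ((2 : ℝ) ^ k) (2 ^ (k + 1)), ENNReal.ofReal (r * ballInf p r) :=
          lintegral_mono_set hcover
      _ ≤ ∑' k : ℕ, ∫⁻ r in Ico ((2 : ℝ) ^ k) (2 ^ (k + 1)), ENNReal.ofReal (r * ballInf p r) :=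
          lintegral_iUnion_le _ _
      _ ≤ ∑' k : ℕ, ENNReal.ofReal (4 ^ (k + 1) * ballInf p (2 ^ k)) :=
          ENNReal.tsum_le_tsum hpiece
      _ < ⊤ := by
          rw [← ENNReal.ofReal_tsum_of_nonneg (fun k => mul_nonneg (by positivity)
            (ballInf_nonneg hp _)) H3]
          exact ENNReal.ofReal_lt_top
  exact this.ne hq

/-! ### From convergent integrals to sums over levels -/

theorem summable_of_lintegral_lt_top {ζ : ℕ → ℝ} (hζ : StrictMono ζ) (hζt : Tendsto ζ atTop atTop)
    {F : ℝ → ℝ} (hF : ∫⁻ z in Ioi (1 : ℝ), ENNReal.ofReal (F z) < ⊤) {b : ℕ → ℝ}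
    (hb0 : ∀ j, 0 ≤ b j)
    (hb : ∀ j, ∀ z ∈ Ioo (ζ j) (ζ (j + 1)), b j ≤ (ζ (j + 1) - ζ j) * F z) : Summable b := by
  -- The integral sees only levels above 1; the finitely many steps starting lower are dropped.
  obtain ⟨J, hJ⟩ := (hζt.eventually (eventually_ge_atTop 1)).exists
  refine (summable_nat_add_iff J).1 ?_
  set I : ℕ → Set ℝ := fun j => Ioo (ζ (j + J)) (ζ (j + J + 1)) with hI
  have hpiece : ∀ j, ENNReal.ofReal (b (j + J)) ≤ ∫⁻ z in I j, ENNReal.ofReal (F z) := by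
    intro j
    have hd : 0 < ζ (j + J + 1) - ζ (j + J) := sub_pos.2 (hζ (Nat.lt_succ_self _))
    have h1 : ∀ z ∈ I j, ENNReal.ofReal (b (j + J) / (ζ (j + J + 1) - ζ (j + J))) ≤
        ENNReal.ofReal (F z) := fun z hz =>
      ENNReal.ofReal_le_ofReal ((div_le_iff₀' hd).2 (hb _ z hz))
    refine le_trans (le_of_eq ?_) (setLIntegral_mono' measurableSet_Ioo h1)
    rw [setLIntegral_const, Real.volume_Ioo, ← ENNReal.ofReal_mul (div_nonneg (hb0 _) hd.le),
      div_mul_cancel₀ _ hd.ne']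
  have hdisj : Pairwise (Function.onFun Disjoint I) := by
    have key : ∀ i j, i < j → Disjoint (I i) (I j) := by
      intro i j hij
      refine Set.disjoint_left.2 fun z hz hz' => ?_
      have := hζ.monotone (show i + J + 1 ≤ j + J by omega)
      linarith [hz.2, hz'.1]
    intro i j hij
    rcases lt_or_gt_of_ne hij with h | h
    · exact key i j h
    · exact (key j i h).symm
  have hsum : ∑' j, ENNReal.ofReal (b (j + J)) < ⊤ := by
    calc _ ≤ ∑' j, ∫⁻ z in I j, ENNReal.ofReal (F z) := ENNReal.tsum_le_tsum hpiece
      _ = ∫⁻ z in ⋃ j, I j, ENNReal.ofReal (F z) :=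
          (lintegral_iUnion (fun _ => measurableSet_Ioo) hdisj _).symm
      _ ≤ ∫⁻ z in Ioi (1 : ℝ), ENNReal.ofReal (F z) := by
          refine lintegral_mono_set (iUnion_subset fun j z hz => ?_)
          exact (hJ.trans (hζ.monotone (Nat.le_add_left J j))).trans_lt hz.1
      _ < ⊤ := hF
  refine (ENNReal.summable_toReal hsum.ne).congr fun j => ?_
  rw [ENNReal.toReal_ofReal (hb0 _)]

/-- Geometric levels with ratio `√θ`, with the lower bounds of `φ` between consecutive levels. -/
theorem exists_level_bounds {φ : ℝ → ℝ} (hφ : IsAdmissible φ) {θ : ℝ} (hθ : 1 < θ) {ε : ℝ}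
    (hε : 0 < ε) : ∃ γ : ℕ → ℝ, (∀ j, 0 < γ j) ∧
      (∀ j, ∀ z ∈ Icc (ε * √θ ^ j) (ε * √θ ^ (j + 1)), γ j ≤ φ z) ∧
      ∀ j, ∀ z ∈ Ioo (ε * √θ ^ j) (ε * √θ ^ (j + 1)), 0 < dilInf θ φ z ∧ dilInf θ φ z ≤ γ j := by
  have hβ : 1 < √θ := by rwa [Real.lt_sqrt zero_le_one, one_pow]
  have hβ2 : √θ * √θ = θ := Real.mul_self_sqrt (by linarith)
  have hle : ∀ j, ε * √θ ^ j ≤ ε * √θ ^ (j + 1) := fun j => by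
    gcongr
    · exact hβ.le
    · omega
  have hpos : ∀ j, 0 < ε * √θ ^ j := fun j => by positivity
  have hinf : ∀ {s K : Set ℝ}, s ⊆ K → s.Nonempty → IsCompact K → K ⊆ Ioi 0 →
      0 < sInf (φ '' s) := by
    intro s K hsK hs hK hK0
    obtain ⟨c, hc, hcK⟩ := hφ.inf_pos K hK hK0
    refine hc.trans_le (le_csInf (hs.image _) ?_)
    rintro _ ⟨z, hz, rfl⟩
    exact hcK z (hsK hz)
  have hbdd : ∀ {s : Set ℝ}, s ⊆ Ioi 0 → BddBelow (φ '' s) := by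
    rintro s hs
    refine ⟨0, ?_⟩
    rintro _ ⟨z, hz, rfl⟩
    exact (hφ.pos z (hs hz)).le
  have hIcc : ∀ j, Icc (ε * √θ ^ j) (ε * √θ ^ (j + 1)) ⊆ Ioi 0 := fun j z hz =>
    (hpos j).trans_le hz.1
  refine ⟨fun j => sInf (φ '' Icc (ε * √θ ^ j) (ε * √θ ^ (j + 1))),
    fun j => hinf le_rfl (nonempty_Icc.2 (hle j)) isCompact_Icc (hIcc j),
    fun j z hz => csInf_le (hbdd (hIcc j)) ⟨z, hz, rfl⟩, fun j z hz => ?_⟩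
  have hz0 : 0 < z := (hpos j).trans hz.1
  have hθ0 : 0 < θ := by linarith
  have hsub : Icc (z / θ) (θ * z) ⊆ Ioi 0 := fun y hy => (div_pos hz0 hθ0).trans_le hy.1
  have hlt : z / θ < θ * z := (div_lt_self hz0 hθ).trans (by nlinarith)
  -- With ratio √θ, the closed step around z lies inside (z/θ, θz), so the infimum over the latter
  -- is the smaller one.
  refine ⟨hinf Ioo_subset_Icc_self (nonempty_Ioo.2 hlt) isCompact_Icc hsub,
    csInf_le_csInf (hbdd (Ioo_subset_Icc_self.trans hsub)) ((nonempty_Icc.2 (hle j)).image _)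
      (image_mono fun y hy => ?_)⟩
  have e : ε * √θ ^ (j + 1) = ε * √θ ^ j * √θ := by ring
  have h1 := hz.1
  have h2 := hz.2
  have h3 := hy.1
  have h4 := hy.2
  rw [e] at h2 h4
  have hβ0 : 0 < √θ := by linarith
  have h5 := mul_lt_mul_of_pos_right h1 hβ0
  have h6 := mul_lt_mul_of_pos_right hβ (mul_pos hz0 hβ0)
  have h7 := mul_lt_mul_of_pos_right hβ (mul_pos (hpos j) hβ0)
  constructor
  · rw [div_lt_iff₀ hθ0, ← hβ2]
    nlinarith
  · rw [← hβ2]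
    nlinarith

theorem tendsto_levels {θ : ℝ} (hθ : 1 < θ) {ε : ℝ} (hε : 0 < ε) :
    StrictMono (fun j : ℕ => ε * √θ ^ j) ∧ Tendsto (fun j : ℕ => ε * √θ ^ j) atTop atTop := by
  have hβ : 1 < √θ := by rwa [Real.lt_sqrt zero_le_one, one_pow]
  exact ⟨fun i j hij => by dsimp only; gcongr,
    (tendsto_pow_atTop_atTop_of_one_lt hβ).const_mul_atTop hε⟩

theorem summable_levels_div {φ : ℝ → ℝ} {θ : ℝ} (hθ : 1 < θ) {ε : ℝ} (hε : 0 < ε) {η : ℕ → ℝ}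
    (hη : ∀ j, 0 < η j)
    (hdil : ∀ j, ∀ z ∈ Ioo (ε * √θ ^ j) (ε * √θ ^ (j + 1)), 0 < dilInf θ φ z ∧ dilInf θ φ z ≤ η j)
    (hint : ∫⁻ z in Ioi (1 : ℝ), ENNReal.ofReal (1 / dilInf θ φ z) < ⊤) :
    Summable fun j : ℕ => (ε * √θ ^ (j + 1) - ε * √θ ^ j) / η j := by
  obtain ⟨hmono, htop⟩ := tendsto_levels hθ hε
  have hd : ∀ j : ℕ, 0 ≤ ε * √θ ^ (j + 1) - ε * √θ ^ j := fun j =>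
    sub_nonneg.2 (hmono j.lt_succ_self).le
  refine summable_of_lintegral_lt_top hmono htop hint (fun j => div_nonneg (hd j) (hη j).le)
    fun j z hz => ?_
  obtain ⟨h1, h2⟩ := hdil j z hz
  rw [div_eq_mul_one_div]
  exact mul_le_mul_of_nonneg_left (one_div_le_one_div_of_le h1 h2) (hd j)

/-- For geometric levels ζ_{j+1}/d_j is the constant √θ/(√θ - 1), so √(d_j/γ_j) is a fixed multiple
of d_j (γ_j ζ_{j+1})^(-1/2), which the integral dominates. -/
theorem summable_sqrt_levels_div {φ : ℝ → ℝ} {θ : ℝ} (hθ : 1 < θ) {ε : ℝ} (hε : 0 < ε)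
    {γ : ℕ → ℝ} (hγ : ∀ j, 0 < γ j)
    (hdil : ∀ j, ∀ z ∈ Ioo (ε * √θ ^ j) (ε * √θ ^ (j + 1)), 0 < dilInf θ φ z ∧ dilInf θ φ z ≤ γ j)
    (hint : ∫⁻ z in Ioi (1 : ℝ), ENNReal.ofReal ((dilInf θ φ z * z) ^ (-(1 / 2) : ℝ)) < ⊤) :
    Summable fun j : ℕ => √((ε * √θ ^ (j + 1) - ε * √θ ^ j) / γ j) := by
  obtain ⟨hmono, htop⟩ := tendsto_levels hθ hε
  have hβ : 1 < √θ := by rwa [Real.lt_sqrt zero_le_one, one_pow]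
  have hpos : ∀ j : ℕ, 0 < ε * √θ ^ j := fun j => by positivity
  have hd : ∀ j : ℕ, 0 < ε * √θ ^ (j + 1) - ε * √θ ^ j := fun j =>
    sub_pos.2 (hmono j.lt_succ_self)
  have key : Summable fun j : ℕ =>
      (ε * √θ ^ (j + 1) - ε * √θ ^ j) * (γ j * (ε * √θ ^ (j + 1))) ^ (-(1 / 2) : ℝ) := by
    refine summable_of_lintegral_lt_top hmono htop hint (fun j => ?_) fun j z hz => ?_
    · have := hd j
      have := hγ j
      positivity
    obtain ⟨h1, h2⟩ := hdil j z hz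
    have hz0 : 0 < z := (hpos j).trans hz.1
    refine mul_le_mul_of_nonneg_left ?_ (hd j).le
    refine Real.rpow_le_rpow_of_nonpos (mul_pos h1 hz0) ?_ (by norm_num)
    exact mul_le_mul h2 hz.2.le hz0.le (hγ j).le
  refine (key.mul_left √(√θ / (√θ - 1))).congr fun j => ?_
  have h1 : 0 < √θ - 1 := by linarith
  have h2 := hd j
  have h3 := hγ j
  have h4 := hpos (j + 1)
  rw [show (-(1 / 2) : ℝ) = -(1 / 2 : ℝ) by norm_num, Real.rpow_neg (by positivity),
    ← Real.sqrt_eq_rpow, ← Real.sqrt_inv]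
  have h5 : (√θ - 1) * (ε * √θ ^ (j + 1)) = √θ * (ε * √θ ^ (j + 1) - ε * √θ ^ j) := by ring
  have h6 : √θ / (√θ - 1) = ε * √θ ^ (j + 1) / (ε * √θ ^ (j + 1) - ε * √θ ^ j) := by
    rw [div_eq_div_iff h1.ne' h2.ne']
    linarith
  rw [h6]
  generalize ε * √θ ^ (j + 1) - ε * √θ ^ j = d at *
  generalize ε * √θ ^ (j + 1) = z at *
  calc √(z / d) * (d * √(γ j * z)⁻¹) = √(z / d) * (√(d ^ 2) * √(γ j * z)⁻¹) := by
        rw [Real.sqrt_sq h2.le]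
    _ = √(d / γ j) := by
        rw [← Real.sqrt_mul (by positivity), ← Real.sqrt_mul (by positivity)]
        congr 1
        field_simp

/-! ### Second-order conditions and radial functions -/

/-- A negative second derivative would make s a local maximum as well, so φ would be locally
constant and the second derivative zero. -/
theorem deriv_deriv_nonneg_of_isLocalMin {φ : ℝ → ℝ} {s : ℝ} (hφ : IsLocalMin φ s)
    (hc : ContinuousAt φ s) : 0 ≤ deriv (deriv φ) s := by
  by_contra! hneg
  have hmax := isLocalMax_of_deriv_deriv_neg hneg hφ.deriv_eq_zero hc
  have hconst : φ =ᶠ[𝓝 s] fun _ => φ s := by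
    filter_upwards [hφ, hmax] with y h1 h2 using le_antisymm h2 h1
  have h1 : deriv φ =ᶠ[𝓝 s] fun _ => 0 := by
    filter_upwards [hconst.eventuallyEq_nhds] with y hy
    rw [hy.deriv_eq, deriv_const]
  rw [h1.deriv_eq, deriv_const] at hneg
  exact lt_irrefl _ hneg

theorem fderiv_fderiv_nonneg_of_isLocalMin {E : Type*} [NormedAddCommGroup E] [NormedSpace ℝ E]
    {ψ : E → ℝ} (hψ : ContDiff ℝ 2 ψ) {x : E} (hmin : IsLocalMin ψ x) (ξ : E) :
    0 ≤ fderiv ℝ (fderiv ℝ ψ) x ξ ξ := by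
  have hψ1 : ContDiff ℝ 1 (fderiv ℝ ψ) := hψ.fderiv_right (by norm_num)
  have hline : ∀ s : ℝ, HasDerivAt (fun s : ℝ => x + s • ξ) ξ s := fun s => by
    simpa using ((hasDerivAt_id s).smul_const ξ).const_add x
  have h1 : deriv (fun s : ℝ => ψ (x + s • ξ)) = fun s => fderiv ℝ ψ (x + s • ξ) ξ := by
    funext s
    exact ((hψ.differentiable (by norm_num) _).hasFDerivAt.comp_hasDerivAt s (hline s)).deriv
  have h2 : deriv (deriv fun s : ℝ => ψ (x + s • ξ)) 0 = fderiv ℝ (fderiv ℝ ψ) x ξ ξ := by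
    rw [h1]
    have h3 := (hψ1.differentiable (by norm_num) _).hasFDerivAt.comp_hasDerivAt 0 (hline 0)
    have h4 := h3.clm_apply (hasDerivAt_const (0 : ℝ) ξ)
    simpa using h4.deriv
  have hcont : Continuous fun s : ℝ => x + s • ξ := by fun_prop
  rw [← h2]
  refine deriv_deriv_nonneg_of_isLocalMin ?_ (hψ.continuous.comp hcont).continuousAt
  have ht : Tendsto (fun s : ℝ => x + s • ξ) (𝓝 0) (𝓝 x) := by
    simpa using hcont.tendsto 0
  simpa [IsLocalMin, IsMinFilter] using ht.eventually hmin

open scoped MatrixOrder in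
-- Writing H = BᵀB turns the sum into values of the quadratic form of a at the rows of B; no
-- symmetry of a is needed.
theorem sum_mul_nonneg_of_posSemidef {n : ℕ} {a : Fin n → Fin n → ℝ}
    (ha : ∀ ξ : EuclideanSpace ℝ (Fin n), 0 ≤ ∑ i, ∑ j, a i j * ξ i * ξ j)
    {H : Matrix (Fin n) (Fin n) ℝ} (hH : H.PosSemidef) : 0 ≤ ∑ i, ∑ j, a i j * H i j := by
  obtain ⟨B, rfl⟩ := CStarAlgebra.nonneg_iff_eq_star_mul_self.mp hH.nonneg
  have e : ∑ i, ∑ j, a i j * (star B * B) i j =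
      ∑ k, ∑ i, ∑ j, a i j * (WithLp.toLp 2 (B k) : EuclideanSpace ℝ (Fin n)) i *
        (WithLp.toLp 2 (B k) : EuclideanSpace ℝ (Fin n)) j := by
    calc _ = ∑ i, ∑ j, ∑ k, a i j * B k i * B k j := by
          simp only [Matrix.mul_apply, Matrix.star_apply, star_trivial, Finset.mul_sum, mul_assoc]
      _ = ∑ i, ∑ k, ∑ j, a i j * B k i * B k j :=
          Finset.sum_congr rfl fun i _ => Finset.sum_comm
      _ = _ := Finset.sum_comm
  rw [e]
  exact Finset.sum_nonneg fun k _ => ha _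

theorem posSemidef_hessian {n : ℕ}
    (B : EuclideanSpace ℝ (Fin n) →L[ℝ] EuclideanSpace ℝ (Fin n) →L[ℝ] ℝ)
    (hsymm : ∀ ξ η, B ξ η = B η ξ) (hB : ∀ ξ, 0 ≤ B ξ ξ) :
    (Matrix.of fun i j : Fin n =>
      B (EuclideanSpace.single i 1) (EuclideanSpace.single j 1)).PosSemidef := by
  refine .of_dotProduct_mulVec_nonneg ?_ fun x => ?_
  · ext i j
    simp [hsymm]
  · have e : (WithLp.toLp 2 x : EuclideanSpace ℝ (Fin n)) =
        ∑ i, x i • EuclideanSpace.single i (1 : ℝ) := by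
      ext j
      simp [Finset.sum_apply, Pi.single_apply]
    have h := hB (WithLp.toLp 2 x)
    rw [e] at h
    simp only [map_sum, map_smul, sum_apply, smul_apply, smul_eq_mul] at h
    simp only [Finset.mul_sum] at h
    rw [Finset.sum_comm] at h
    simpa [dotProduct, Matrix.mulVec, Finset.mul_sum, mul_assoc, mul_comm, mul_left_comm] using h

theorem radial_hasFDerivAt {E : Type*} [NormedAddCommGroup E] [InnerProductSpace ℝ E]
    {W : ℝ → ℝ} (hW : Differentiable ℝ W) (c : ℝ) (x : E) :
    HasFDerivAt (fun y : E => W (‖y‖ ^ 2 / 2 + c)) (deriv W (‖x‖ ^ 2 / 2 + c) • innerSL ℝ x) x := by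
  have h1 : HasFDerivAt (fun y : E => ‖y‖ ^ 2 / 2 + c) (innerSL ℝ x) x := by
    have h := ((hasStrictFDerivAt_norm_sq x).hasFDerivAt.mul_const (1 / 2 : ℝ)).add_const c
    simp only [mul_one_div] at h
    refine h.congr_fderiv ?_
    ext y
    simp
  exact (hW _).hasDerivAt.comp_hasFDerivAt x h1

theorem radial_fderiv_fderiv {E : Type*} [NormedAddCommGroup E] [InnerProductSpace ℝ E]
    {W : ℝ → ℝ} (hW : ContDiff ℝ 2 W) (c : ℝ) (x ξ η : E) :
    fderiv ℝ (fderiv ℝ fun y : E => W (‖y‖ ^ 2 / 2 + c)) x ξ η =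
      deriv W (‖x‖ ^ 2 / 2 + c) * inner ℝ ξ η +
        deriv (deriv W) (‖x‖ ^ 2 / 2 + c) * (inner ℝ x ξ * inner ℝ x η) := by
  have hW1 : ContDiff ℝ (1 + 1) W := by simpa [one_add_one_eq_two] using hW
  have hW2 := (contDiff_succ_iff_deriv.1 hW1).2.2.differentiable (by norm_num)
  have h1 : (fderiv ℝ fun y : E => W (‖y‖ ^ 2 / 2 + c)) =
      fun y => deriv W (‖y‖ ^ 2 / 2 + c) • innerSL ℝ y := by
    funext y
    exact (radial_hasFDerivAt (hW.differentiable (by norm_num)) c y).fderiv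
  rw [h1]
  have h2 := (radial_hasFDerivAt hW2 c x).smul (innerSL ℝ (E := E)).hasFDerivAt
  have h3 := h2.fderiv
  change fderiv ℝ (fun y => deriv W (‖y‖ ^ 2 / 2 + c) • innerSL ℝ y) x = _ at h3
  rw [h3]
  change deriv W (‖x‖ ^ 2 / 2 + c) * inner ℝ ξ η +
    deriv (deriv W) (‖x‖ ^ 2 / 2 + c) * inner ℝ x ξ * inner ℝ x η = _
  ring

/-! ### Comparison with the barrier -/

/-- At the contact point the Hessian of the barrier, W' I + W'' x⊗x, dominates D²u, and its entries
are at most W' + 2S|W''| because |x|² ≤ 2S. -/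
theorem not_touching {n : ℕ} {a : Fin n → Fin n → EuclideanSpace ℝ (Fin n) → ℝ → ℝ}
    {f : EuclideanSpace ℝ (Fin n) → ℝ → EuclideanSpace ℝ (Fin n) → ℝ}
    (ha : ∀ (x : EuclideanSpace ℝ (Fin n)) (ζ : ℝ) (ξ : EuclideanSpace ℝ (Fin n)),
      ζ ≠ 0 → ξ ≠ 0 → 0 < ∑ i, ∑ j, a i j x ζ * ξ i * ξ j)
    {g h : ℝ → ℝ} {p : EuclideanSpace ℝ (Fin n) → ℝ}
    (hf : ∀ (x : EuclideanSpace ℝ (Fin n)) (ζ l : ℝ), ζ ≠ 0 → 0 ≤ l → l ≤ p x * h |ζ| →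
      p x * g |ζ| * (1 + ∑ i, ∑ j, |a i j x ζ|) ≤ f x ζ (l • x) * Real.sign ζ)
    {u : EuclideanSpace ℝ (Fin n) → ℝ → ℝ} (hu : IsClassicalSubsolution a f u)
    {W : ℝ → ℝ} (hW : ContDiff ℝ 2 W) {x : EuclideanSpace ℝ (Fin n)} {t c S : ℝ} (ht : 0 < t)
    (hc : 0 ≤ c) (hS : S = ‖x‖ ^ 2 / 2 + c) (hpos : 0 < W S) (heq : u x t = W S)
    (hmin : IsLocalMin (fun y => W (‖y‖ ^ 2 / 2 + c) - u y t) x)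
    (htime : -deriv W S ≤ timeDeriv u x t) (hW0 : 0 ≤ deriv W S) (hpx : 0 < p x)
    (hg : 0 < g (W S)) (hh : deriv W S ≤ p x * h (W S))
    (hg2 : deriv W S + 2 * S * |deriv (deriv W) S| ≤ p x * g (W S) / 2) : False := by
  set v : EuclideanSpace ℝ (Fin n) → ℝ := fun y => W (‖y‖ ^ 2 / 2 + c) with hv
  have cv : ContDiff ℝ 2 v := hW.comp (((contDiff_norm_sq ℝ).div_const 2).add contDiff_const)
  have cu : ContDiff ℝ 2 fun y => u y t := hu.isC21.contDiff_space t ht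
  have dv := cv.differentiable (by norm_num)
  have du := cu.differentiable (by norm_num)
  have e1 : fderiv ℝ (fun y => v y - u y t) = fun y => fderiv ℝ v y - fderiv ℝ (fun y => u y t) y :=
    funext fun y => fderiv_fun_sub (dv y) (du y)
  have hv1 : fderiv ℝ v x = deriv W S • innerSL ℝ x := by
    rw [hS]
    exact (radial_hasFDerivAt (hW.differentiable (by norm_num)) c x).fderiv
  have hgrad : spaceGrad u x t = deriv W S • x := by
    have h0 := hmin.fderiv_eq_zero
    rw [e1] at h0
    have h1 : fderiv ℝ (fun y => u y t) x = deriv W S • innerSL ℝ x := by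
      rw [← hv1]
      exact (sub_eq_zero.1 h0).symm
    refine HasGradientAt.gradient (hasGradientAt_iff_hasFDerivAt.2 ?_)
    refine (du x).hasFDerivAt.congr_fderiv (h1.trans ?_)
    ext y
    simp
  have hψ : ContDiff ℝ 2 fun y => v y - u y t := cv.sub cu
  set B := fderiv ℝ (fderiv ℝ fun y => v y - u y t) x with hB
  have hBeq : ∀ ξ η, B ξ η = deriv W S * inner ℝ ξ η +
      deriv (deriv W) S * (inner ℝ x ξ * inner ℝ x η) - spaceHess u x t ξ η := by
    intro ξ η
    have d1 : DifferentiableAt ℝ (fderiv ℝ v) x :=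
      (cv.fderiv_right (m := 1) (by norm_num)).differentiable (by norm_num) x
    have d2 : DifferentiableAt ℝ (fderiv ℝ fun y => u y t) x :=
      (cu.fderiv_right (m := 1) (by norm_num)).differentiable (by norm_num) x
    rw [hB, e1, fderiv_fun_sub d1 d2, sub_apply, sub_apply, hS,
      ← radial_fderiv_fderiv hW c x ξ η]
    rfl
  have hBsymm : ∀ ξ η, B ξ η = B η ξ :=
    hψ.contDiffAt.isSymmSndFDerivAt (by simp)
  have hne : u x t ≠ 0 := by rw [heq]; exact hpos.ne'
  have hsum := sum_mul_nonneg_of_posSemidef (a := fun i j => a i j x (u x t)) (fun ξ => by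
    rcases eq_or_ne ξ 0 with rfl | hξ
    · simp
    · exact (ha x _ ξ hne hξ).le)
    (posSemidef_hessian B hBsymm (fderiv_fderiv_nonneg_of_isLocalMin hψ hmin))
  set E : Fin n → EuclideanSpace ℝ (Fin n) := fun i => EuclideanSpace.single i 1 with hE
  have hEn : ∀ i, ‖E i‖ = 1 := fun i => by simp [hE]
  set D := p x * g (W S) / 2 with hD
  have hxS : ‖x‖ ^ 2 ≤ 2 * S := by rw [hS]; linarith
  have hentry : ∀ i j, |deriv W S * inner ℝ (E i) (E j) +
      deriv (deriv W) S * (inner ℝ x (E i) * inner ℝ x (E j))| ≤ D := by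
    intro i j
    have b1 : |inner ℝ (E i) (E j)| ≤ 1 := by
      simpa [hEn] using abs_real_inner_le_norm (E i) (E j)
    have b2 : ∀ k, |inner ℝ x (E k)| ≤ ‖x‖ := fun k => by
      simpa [hEn] using abs_real_inner_le_norm x (E k)
    calc _ ≤ deriv W S * |inner ℝ (E i) (E j)| +
          |deriv (deriv W) S| * (|inner ℝ x (E i)| * |inner ℝ x (E j)|) := by
          refine (abs_add_le _ _).trans_eq ?_
          rw [abs_mul, abs_mul, abs_mul, abs_of_nonneg hW0]
      _ ≤ deriv W S * 1 + |deriv (deriv W) S| * (‖x‖ * ‖x‖) := by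
          gcongr
          · exact b2 i
          · exact b2 j
      _ ≤ deriv W S * 1 + |deriv (deriv W) S| * (2 * S) := by
          refine add_le_add le_rfl (mul_le_mul_of_nonneg_left ?_ (abs_nonneg _))
          linarith [sq ‖x‖]
      _ ≤ D := by linarith
  have hle : ∑ i, ∑ j, a i j x (u x t) * spaceDeriv₂ u i j x t ≤
      (∑ i, ∑ j, |a i j x (u x t)|) * D := by
    have h1 : ∀ i j, a i j x (u x t) * spaceDeriv₂ u i j x t +
        a i j x (u x t) * B (E i) (E j) ≤ |a i j x (u x t)| * D := by
      intro i j
      have h2 := hBeq (E i) (E j)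
      have h3 : spaceDeriv₂ u i j x t + B (E i) (E j) = deriv W S * inner ℝ (E i) (E j) +
          deriv (deriv W) S * (inner ℝ x (E i) * inner ℝ x (E j)) := by
        rw [h2]
        simp [spaceDeriv₂, hE]
      rw [← mul_add, h3]
      refine (le_abs_self _).trans ?_
      rw [abs_mul]
      exact mul_le_mul_of_nonneg_left (hentry i j) (abs_nonneg _)
    have h4 := Finset.sum_le_sum fun i (_ : i ∈ Finset.univ) =>
      Finset.sum_le_sum fun j (_ : j ∈ Finset.univ) => h1 i j
    simp only [Finset.sum_add_distrib, ← Finset.sum_mul] at h4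
    simp only [Matrix.of_apply] at hsum
    linarith
  have hfx := hf x (u x t) (deriv W S) hne hW0
  rw [heq, abs_of_pos hpos, Real.sign_of_pos hpos, mul_one] at hfx
  have hfx := hfx hh
  have hineq := hu.inequality x t ht
  rw [hgrad, heq] at hineq
  rw [heq] at hle
  have hA : 0 ≤ ∑ i, ∑ j, |a i j x (W S)| :=
    Finset.sum_nonneg fun i _ => Finset.sum_nonneg fun j _ => abs_nonneg _
  generalize ∑ i, ∑ j, |a i j x (W S)| = A at *
  have hDp : 0 < D := by positivity
  have hS0 : 0 ≤ S := by rw [hS]; positivity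
  have hWD : deriv W S ≤ D := by
    have : 0 ≤ 2 * S * |deriv (deriv W) S| := by positivity
    linarith
  have e3 : p x * g (W S) = 2 * D := by rw [hD]; ring
  rw [e3] at hfx
  -- The left side of the differential inequality is at least -D - AD + 2D(1 + A) = D(1 + A) > 0.
  nlinarith [mul_nonneg hA hDp.le]

theorem nonpos_of_hasDerivAt_of_nonneg_left {F : ℝ → ℝ} {F' t : ℝ} (hF : HasDerivAt F F' t)
    (h0 : F t = 0) (hpos : ∀ᶠ s in 𝓝[<] t, 0 ≤ F s) : F' ≤ 0 := by
  have h1 := (hasDerivWithinAt_iff_tendsto_slope' (self_notMem_Iio (a := t))).1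
    hF.hasDerivWithinAt
  refine le_of_tendsto h1 ?_
  filter_upwards [hpos, self_mem_nhdsWithin] with s hs hst
  rw [slope_def_field, h0, sub_zero]
  exact div_nonpos_of_nonneg_of_nonpos hs (sub_nonpos.2 (le_of_lt hst))

theorem lt_barrier {n : ℕ} {a : Fin n → Fin n → EuclideanSpace ℝ (Fin n) → ℝ → ℝ}
    {f : EuclideanSpace ℝ (Fin n) → ℝ → EuclideanSpace ℝ (Fin n) → ℝ}
    (ha : ∀ (x : EuclideanSpace ℝ (Fin n)) (ζ : ℝ) (ξ : EuclideanSpace ℝ (Fin n)),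
      ζ ≠ 0 → ξ ≠ 0 → 0 < ∑ i, ∑ j, a i j x ζ * ξ i * ξ j)
    {g h : ℝ → ℝ} {p : EuclideanSpace ℝ (Fin n) → ℝ}
    (hf : ∀ (x : EuclideanSpace ℝ (Fin n)) (ζ l : ℝ), ζ ≠ 0 → 0 ≤ l → l ≤ p x * h |ζ| →
      p x * g |ζ| * (1 + ∑ i, ∑ j, |a i j x ζ|) ≤ f x ζ (l • x) * Real.sign ζ)
    {u : EuclideanSpace ℝ (Fin n) → ℝ → ℝ} (hu : IsClassicalSubsolution a f u)
    (hp : ∀ x, 0 < p x) (hg : ∀ ζ, 0 < ζ → 0 < g ζ)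
    {R T : ℝ} (hRT : R < T) {W : ℝ → ℝ} (hW : ContDiff ℝ 2 W) (hW0 : ∀ S, 0 < W S)
    (hW1 : ∀ S, 0 ≤ deriv W S)
    (hWp : ∀ (x : EuclideanSpace ℝ (Fin n)) S, ‖x‖ ^ 2 / 2 ≤ S → deriv W S ≤ p x * h (W S) ∧
      deriv W S + 2 * S * |deriv (deriv W) S| ≤ p x * g (W S) / 2)
    (hbig : ∀ x t, T - R ≤ t → t ≤ T → ‖x‖ ^ 2 / 2 + (T - t) = R → u x t < W R)
    {x : EuclideanSpace ℝ (Fin n)} (hx : ‖x‖ ^ 2 / 2 ≤ R) : u x T < W (‖x‖ ^ 2 / 2) := by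
  have hR0 : 0 ≤ R := le_trans (by positivity) hx
  by_contra! hcon
  set s : EuclideanSpace ℝ (Fin n) × ℝ → ℝ := fun z => ‖z.1‖ ^ 2 / 2 + (T - z.2) with hs
  have cs : Continuous s := by fun_prop
  set φ : EuclideanSpace ℝ (Fin n) × ℝ → ℝ := fun z => W (s z) - u z.1 z.2 with hφ
  have cφ : ContinuousOn φ (univ ×ˢ Ioi 0) :=
    (hW.continuous.comp cs).continuousOn.sub hu.isC21.continuousOn
  set D : Set (EuclideanSpace ℝ (Fin n) × ℝ) := {z | T - R ≤ z.2 ∧ z.2 ≤ T ∧ s z ≤ R} with hD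
  have hDclosed : IsClosed D :=
    (isClosed_le continuous_const continuous_snd).inter
      ((isClosed_le continuous_snd continuous_const).inter (isClosed_le cs continuous_const))
  have hDcompact : IsCompact D := by
    refine IsCompact.of_isClosed_subset
      ((isCompact_closedBall (0 : EuclideanSpace ℝ (Fin n)) (1 + 2 * R)).prod
        (isCompact_Icc (a := T - R) (b := T))) hDclosed ?_
    rintro z ⟨h1, h2, h3⟩
    refine ⟨?_, h1, h2⟩
    simp only [hs] at h3
    rw [mem_closedBall_zero_iff]
    nlinarith [sq_nonneg (‖z.1‖ - 1)]
  have hDpos : D ⊆ univ ×ˢ Ioi 0 := fun z hz => ⟨mem_univ _, by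
    have := hz.1
    simp only [mem_Ioi]
    linarith⟩
  have hAc : IsCompact (D ∩ φ ⁻¹' Iic 0) :=
    hDcompact.of_isClosed_subset
      ((cφ.mono hDpos).preimage_isClosed_of_isClosed hDclosed isClosed_Iic) inter_subset_left
  -- Earliest time in the cap at which u reaches the barrier.
  obtain ⟨⟨x₁, t₁⟩, ⟨hzD, hz0⟩, hzmin⟩ := hAc.exists_isMinOn
    ⟨(x, T), ⟨by simp only [hD, hs, mem_ofPred_eq]; refine ⟨by linarith, le_rfl, by simpa using hx⟩,
      by simpa [hφ, hs] using hcon⟩⟩ continuous_snd.continuousOn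
  obtain ⟨ht1, ht2, hsR⟩ := hzD
  simp only at ht1 ht2
  have ht0 : 0 < t₁ := by linarith
  have hlt : s (x₁, t₁) < R := by
    refine hsR.lt_of_ne fun he => ?_
    have h1 := hbig x₁ t₁ ht1 ht2 he
    simp only [mem_preimage, mem_Iic, hφ, he] at hz0
    linarith
  have ht1' : T - R < t₁ := by
    have : 0 ≤ ‖x₁‖ ^ 2 / 2 := by positivity
    simp only [hs] at hlt
    linarith
  have hnear : ∀ᶠ z in 𝓝 (x₁, t₁), z.2 < t₁ → 0 < φ z := by
    filter_upwards [cs.continuousAt.eventually (gt_mem_nhds hlt),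
      continuous_snd.continuousAt.eventually (lt_mem_nhds ht1')] with z hz1 hz2 hz3
    by_contra! hle
    have := hzmin (a := z) ⟨⟨hz2.le, by linarith, hz1.le⟩, hle⟩
    simp only [mem_ofPred_eq] at this
    linarith
  -- Positivity at nearby earlier times passes to the slice t = t₁ by continuity; this makes x₁ a
  -- spatial minimum.
  have hslice : ∀ᶠ y in 𝓝 x₁, 0 ≤ φ (y, t₁) := by
    have hc : Tendsto (fun y => (y, t₁)) (𝓝 x₁) (𝓝 (x₁, t₁)) :=
      (Continuous.prodMk_left t₁).tendsto x₁
    filter_upwards [hc.eventually hnear.eventually_nhds] with y hy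
    have hc2 : Tendsto (fun r => (y, r)) (𝓝[<] t₁) (𝓝 (y, t₁)) :=
      ((Continuous.prodMk_right y).tendsto t₁).mono_left nhdsWithin_le_nhds
    have hc3 : ContinuousAt φ (y, t₁) :=
      cφ.continuousAt ((isOpen_univ.prod isOpen_Ioi).mem_nhds ⟨mem_univ _, ht0⟩)
    refine ge_of_tendsto (hc3.tendsto.comp hc2) ?_
    filter_upwards [hc2.eventually hy, self_mem_nhdsWithin] with r hr hrt
    exact (hr hrt).le
  have hφ0 : φ (x₁, t₁) = 0 := le_antisymm hz0 hslice.self_of_nhds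
  have hdW : HasDerivAt (fun r => φ (x₁, r))
      (deriv W (s (x₁, t₁)) * (-1) - timeDeriv u x₁ t₁) t₁ := by
    have h1 : HasDerivAt (fun r => s (x₁, r)) (-1) t₁ :=
      ((hasDerivAt_id t₁).const_sub T).const_add (‖x₁‖ ^ 2 / 2)
    exact ((hW.differentiable (by norm_num) _).hasDerivAt.comp t₁ h1).sub
      (hu.isC21.differentiableAt_time x₁ t₁ ht0).hasDerivAt
  -- Only earlier times are used, since t₁ may equal T.
  have htime := nonpos_of_hasDerivAt_of_nonneg_left hdW hφ0 (by
    have hc2 : Tendsto (fun r => (x₁, r)) (𝓝[<] t₁) (𝓝 (x₁, t₁)) :=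
      ((Continuous.prodMk_right x₁).tendsto t₁).mono_left nhdsWithin_le_nhds
    filter_upwards [hc2.eventually hnear, self_mem_nhdsWithin] with r hr hrt
    exact (hr hrt).le)
  obtain ⟨hb1, hb2⟩ := hWp x₁ (s (x₁, t₁)) (by simp only [hs]; linarith)
  refine not_touching ha hf hu hW (c := T - t₁) ht0 (by linarith) rfl (hW0 _)
    (sub_eq_zero.1 hφ0).symm ?_ (by linarith) (hW1 _) (hp x₁) (hg _ (hW0 _)) hb1 hb2
  filter_upwards [hslice] with y hy
  exact hφ0.trans_le hy

/-! ### Conclusion -/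

theorem theorem2p2 (n : ℕ) (hn : 1 ≤ n)
    (a : Fin n → Fin n → EuclideanSpace ℝ (Fin n) → ℝ → ℝ)
    (f : EuclideanSpace ℝ (Fin n) → ℝ → EuclideanSpace ℝ (Fin n) → ℝ)
    (ha : ∀ (x : EuclideanSpace ℝ (Fin n)) (ζ : ℝ) (ξ : EuclideanSpace ℝ (Fin n)),
      ζ ≠ 0 → ξ ≠ 0 → 0 < ∑ i, ∑ j, a i j x ζ * ξ i * ξ j)
    (g h : ℝ → ℝ) (hg : IsAdmissible g) (hh : IsAdmissible h)
    (p : EuclideanSpace ℝ (Fin n) → ℝ) (hp : ∀ x, 0 ≤ p x)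
    (hp_meas : AEMeasurable p volume)
    (hp_bdd : ∀ K : Set (EuclideanSpace ℝ (Fin n)), IsCompact K → ∃ C, ∀ x ∈ K, p x ≤ C)
    (hf : ∀ (x : EuclideanSpace ℝ (Fin n)) (ζ l : ℝ), ζ ≠ 0 → 0 ≤ l → l ≤ p x * h |ζ| →
      p x * g |ζ| * (1 + ∑ i, ∑ j, |a i j x ζ|) ≤ f x ζ (l • x) * Real.sign ζ)
    (θ : ℝ) (hθ : 1 < θ)
    (hq_int : ∫⁻ r in Ioi (1 : ℝ), ENNReal.ofReal (r * ballInf p r) = ⊤)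
    (hg_int : ∫⁻ ζ in Ioi (1 : ℝ),
      ENNReal.ofReal ((dilInf θ g ζ * ζ) ^ (-(1 / 2) : ℝ)) < ⊤)
    (hh_int : ∫⁻ ζ in Ioi (1 : ℝ), ENNReal.ofReal (1 / dilInf θ h ζ) < ⊤)
    (u : EuclideanSpace ℝ (Fin n) → ℝ → ℝ) (hu : IsClassicalSubsolution a f u)
    (K : Set (EuclideanSpace ℝ (Fin n))) (hK : IsCompact K) :
    Tendsto (fun t : ℝ => sSup ((fun x => max (u x t) 0) '' K)) atTop (𝓝 0) := by

  have key : ∀ ε : ℝ, 0 < ε → ∀ᶠ T in atTop, ∀ x ∈ K, u x T ≤ ε := by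
    intro ε hε
    obtain ⟨γ, hγ0, hγ, hγd⟩ := exists_level_bounds hg hθ hε
    obtain ⟨η, hη0, hη, hηd⟩ := exists_level_bounds hh hθ hε
    obtain ⟨hmono, htop⟩ := tendsto_levels hθ hε
    obtain ⟨b, hb⟩ := hK.isBounded.exists_norm_le
    obtain ⟨k₀, hk₀⟩ := pow_unbounded_of_one_lt (b ^ 2 / 2) (show (1 : ℝ) < 4 by norm_num)
    obtain ⟨R, hk₀R, hR⟩ := exists_profile (q := fun k => ballInf p (2 ^ (k + 2)))
      (fun k => ballInf_nonneg hp _) (not_summable_ballInf hp hq_int) hmono hγ0 hη0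
      (fun j z hz => ⟨hγ j z hz, hη j z hz⟩) (summable_sqrt_levels_div hθ hε hγ0 hγd hg_int)
      (summable_levels_div hθ hε hη0 hηd hh_int) k₀
    have hp0 : ∀ x, 0 < p x := fun x =>
      (ballInf_pos hp hq_int (‖x‖ + 1) (by positivity)).trans_le (ballInf_le hp (by linarith))
    -- T > R keeps the cap in positive times, so u is bounded on it; N may then depend on T, while R
    -- does not.
    filter_upwards [eventually_gt_atTop R] with T hT x hx
    have hR0 : 0 < R := lt_of_lt_of_le (by positivity) hk₀R
    have hcompact : IsCompact (Metric.closedBall (0 : EuclideanSpace ℝ (Fin n)) (1 + 2 * R) ×ˢ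
        Icc (T - R) T) := (isCompact_closedBall _ _).prod isCompact_Icc
    obtain ⟨M, hM⟩ := hcompact.exists_bound_of_continuousOn
      (hu.isC21.continuousOn.mono fun z hz => ⟨mem_univ _, by
        have := hz.2.1
        simp only [mem_Ioi]
        linarith⟩)
    obtain ⟨N, hN⟩ := (htop.eventually (eventually_gt_atTop M)).exists
    obtain ⟨W, hW, hW0, hWR, hWε, hW1, hW2⟩ := hR N
    simp only [pow_zero, mul_one] at hW0 hWε
    have hxK : ‖x‖ ^ 2 / 2 ≤ 4 ^ k₀ := by
      have := hb x hx
      have := norm_nonneg x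
      nlinarith
    rw [← hW0 _ hxK]
    refine (lt_barrier ha hf hu hp0 hg.pos hT hW (fun S => hε.trans_le (hWε S)) hW1
      (fun y S hy => ?_) (fun y t h1 h2 h3 => ?_) (hxK.trans hk₀R)).le
    · have hg' := hg.pos _ (hε.trans_le (hWε S))
      have hh' := hh.pos _ (hε.trans_le (hWε S))
      have hpy := hp0 y
      rcases hW2 S with ⟨e1, e2⟩ | ⟨k, -, hSk, h1, h2⟩
      · rw [e1, e2]
        constructor
        · positivity
        · simp only [abs_zero, mul_zero, add_zero]
          positivity
      -- From |y|²/2 ≤ S ≤ 4^(k+1) follows |y|² ≤ 2·4^(k+1) < (2^(k+2))², which is why q is sampled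
      -- at 2^(k+2).
      · have hy2 : ‖y‖ < 2 ^ (k + 2) := by
          refine lt_of_pow_lt_pow_left₀ 2 (by positivity) ?_
          have e : ((2 : ℝ) ^ (k + 2)) ^ 2 = 4 * 4 ^ (k + 1) := by
            rw [← pow_mul, mul_comm, pow_mul]
            norm_num
            ring
          have : (0 : ℝ) < 4 ^ (k + 1) := by positivity
          linarith
        have hqp := ballInf_le hp hy2
        refine ⟨h1.trans (by gcongr), h2.trans (by gcongr)⟩
    · rw [hWR R le_rfl]
      refine lt_of_le_of_lt ((le_abs_self _).trans (hM (y, t) ⟨?_, h1, h2⟩)) hN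
      rw [mem_closedBall_zero_iff]
      nlinarith [sq_nonneg (‖y‖ - 1)]
  rw [Metric.tendsto_nhds]
  intro ε hε
  filter_upwards [key (ε / 2) (by positivity)] with T hT
  have h0 : 0 ≤ sSup ((fun x => max (u x T) 0) '' K) := by
    refine Real.sSup_nonneg ?_
    rintro _ ⟨x, -, rfl⟩
    exact le_max_right _ _
  rw [Real.dist_0_eq_abs, abs_of_nonneg h0]
  -- Nonnegativity of the bound covers empty K, where `sSup` is 0.
  refine lt_of_le_of_lt (Real.sSup_le ?_ (by positivity : (0 : ℝ) ≤ ε / 2)) (by linarith)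
  rintro _ ⟨x, hx, rfl⟩
  exact max_le (hT x hx) (by positivity)
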